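/- Let $L_n^{(\alpha)}(z)=\frac{z^{-\alpha}e^{z}}{n!}\frac{d^n}{dz^n}\left(z^{n+\alpha}e^{-z}\right)$ $(n\ge 0)$ be the associated Laguerre polynomial, i.e. $L_n^{(\alpha)}(z)=\sum_{i=0}^n \frac{(-1)^i(\alpha+i+1)_{n-i}}{(n-i)!\,i!}z^i$, where $(a)_j=a(a+1)\cdots(a+j-1)$. For $\mu\in\mathbb{C}$ and integers $m\ge -1$, $n\ge 0$ put $$T_{m,n}^{(\mu)}(z)=\det\left[\frac{d^{j+k}}{dz^{j+k}}L_{m+n}^{(\mu+1)}(z)\right]_{j,k=0}^{n-1},\qquad \widehat T_{m,n}^{(\mu)}(z)=\det\left[\frac{d^{j+k}}{dz^{j+k}}L_{m+n}^{(\mu+1)}(-z)\right]_{j,k=0}^{n-1}$$ (each equal to $1$ when $n=0$), and for integers $m\ge 1$, $n\ge 0$ put $$w_{m,n}(z;\mu)=\frac{T_{m-1,n}^{(\mu)}(z)\,T_{m-1,n+1}^{(\mu)}(z)}{T_{m,n}^{(\mu)}(z)\,T_{m-2,n+1}^{(\mu)}(z)},\qquad \widehat w_{m,n}(z;\mu)=\frac{\widehat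 T_{m-1,n}^{(\mu)}(z)\,\widehat T_{m-1,n+1}^{(\mu)}(z)}{\widehat T_{m,n}^{(\mu)}(z)\,\widehat T_{m-2,n+1}^{(\mu)}(z)}.$$ Let $m\ge 1$ and $n\ge 0$ be integers, and let $\mu=k$ be an integer with $k\ge -n$. Then $w_{m,n}(z;k)$ and $\widehat w_{m,n+k}(z;-k)$ are two distinct rational functions of $z$ over $\mathbb{C}$, and both are solutions of the fifth Painlevé equation $$\frac{d^2w}{dz^2}=\left(\frac1{2w}+\frac1{w-1}\right)\left(\frac{dw}{dz}\right)^2-\frac1z\frac{dw}{dz}+\frac{(w-1)^2(\alpha w^2+\beta)}{z^2w}+\frac{\gamma w}{z}-\frac{w(w+1)}{2(w-1)}$$ for the same parameters $\alpha=\tfrac12m^2$, $\beta=-\tfrac12(m+2n+k+1)^2$, $\gamma=k$. (Here a rational function is a solution if it is not the constant $0$ or $1$ and satisfies the equation at every $z\ne0$ that is not one of its poles and at which its value is neither $0$ nor $1$.) -/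

import Mathlib

open Polynomial

noncomputable section

namespace PainleveV

/-- The associated Laguerre polynomial `L_n^{(α)}` for `n ≥ 0` and arbitrary complex `α`,
`L_n^{(α)}(z) = ∑_{i=0}^n (-1)^i (α+i+1)_{n-i} / ((n-i)! i!) z^i`, with `(a)_j` the rising
factorial. The theorem `eval_laguerreNat` is Rodrigues' formula for it. -/
def laguerreNat (n : ℕ) (α : ℂ) : ℂ[X] :=
  ∑ i ∈ Finset.range (n + 1),
    C ((-1) ^ i * (ascPochhammer ℂ (n - i)).eval (α + i + 1)
      / ((n - i).factorial * i.factorial)) * X ^ i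

theorem iteratedDeriv_cpow (a : ℂ) (k : ℕ) :
    ∀ z ∈ Complex.slitPlane, iteratedDeriv k (fun x : ℂ => x ^ a) z
      = (descPochhammer ℂ k).eval a * z ^ (a - k) := by
  induction k with
  | zero => intro z _; simp
  | succ k ih =>
    intro z hz
    rw [iteratedDeriv_succ]
    have h : iteratedDeriv k (fun x : ℂ => x ^ a) =ᶠ[nhds z]
        fun x => (descPochhammer ℂ k).eval a * x ^ (a - k) := by
      filter_upwards [Complex.isOpen_slitPlane.mem_nhds hz] with x hx using ih x hx
    rw [h.deriv_eq]
    have hd := ((hasDerivAt_id z).cpow_const (c := a - k) hz).const_mul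
      ((descPochhammer ℂ k).eval a)
    simp only [id] at hd
    rw [hd.deriv, descPochhammer_succ_eval]
    push_cast
    rw [sub_sub]
    ring

/-- Rodrigues' formula
`L_n^{(α)}(z) = (z^{-α} e^z / n!) (d/dz)^n (z^{n+α} e^{-z})`. -/
theorem eval_laguerreNat (n : ℕ) (α z : ℂ) (hz : z ∈ Complex.slitPlane) :
    (laguerreNat n α).eval z = z ^ (-α) * Complex.exp z / n.factorial
      * iteratedDeriv n (fun x : ℂ => x ^ (n + α) * Complex.exp (-x)) z := by
  have hz0 : z ≠ 0 := Complex.slitPlane_ne_zero hz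
  have h1 : ContDiffAt ℂ n (fun x : ℂ => x ^ (n + α)) z :=
    (AnalyticAt.cpow analyticAt_id analyticAt_const hz).contDiffAt
  have h2 : ContDiffAt ℂ n (fun x : ℂ => Complex.exp (-x)) z := by fun_prop
  rw [iteratedDeriv_fun_mul h1 h2, Finset.mul_sum, laguerreNat, eval_finsetSum,
    ← Finset.sum_range_reflect]
  refine Finset.sum_congr rfl fun i hi => ?_
  have hi' : i ≤ n := by simpa [Nat.lt_succ_iff] using hi
  obtain ⟨j, rfl⟩ := Nat.exists_eq_add_of_le hi'
  have e1 : i + j + 1 - 1 - i = j := by omega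
  have e2 : i + j - j = i := by omega
  have e3 : i + j - i = j := by omega
  have hexp : iteratedDeriv j (fun x : ℂ => Complex.exp (-x)) z
      = (-1) ^ j * Complex.exp (-z) := by
    rw [iteratedDeriv_comp_neg j Complex.exp z]
    simp [iteratedDeriv_eq_iterate, Complex.iter_deriv_exp]
  rw [e1, e2, e3, iteratedDeriv_cpow _ _ z hz, hexp,
    descPochhammer_eval_eq_ascPochhammer]
  have e4 : (((i + j : ℕ) : ℂ) + α - i + 1) = α + j + 1 := by push_cast; ring
  have e5 : z ^ (((i + j : ℕ) : ℂ) + α - i) = z ^ α * z ^ j := by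
    rw [← Complex.cpow_natCast, ← Complex.cpow_add _ _ hz0]; congr 1; push_cast; ring
  have e6 : ((i + j).choose i : ℂ) = (i + j).factorial / (i.factorial * j.factorial) := by
    rw [Nat.cast_add_choose]
  have e7 : z ^ (-α) * z ^ α = 1 := by
    rw [← Complex.cpow_add _ _ hz0]; simp
  have e8 : Complex.exp z * Complex.exp (-z) = 1 := by
    rw [← Complex.exp_add]; simp
  have f1 : ((i + j).factorial : ℂ) ≠ 0 := by exact_mod_cast Nat.factorial_ne_zero _
  have f2 : (i.factorial : ℂ) ≠ 0 := by exact_mod_cast Nat.factorial_ne_zero _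
  have f3 : (j.factorial : ℂ) ≠ 0 := by exact_mod_cast Nat.factorial_ne_zero _
  rw [e4, e5, e6]
  simp only [eval_mul, eval_C, eval_pow, eval_X]
  set A := eval (α + j + 1) (ascPochhammer ℂ i)
  calc _ = (-1) ^ j * A / (i.factorial * j.factorial) * z ^ j := by ring
    _ = (-1) ^ j * A / (i.factorial * j.factorial) * z ^ j * (z ^ (-α) * z ^ α)
        * (Complex.exp z * Complex.exp (-z)) := by rw [e7, e8]; ring
    _ = _ := by field_simp

/-- `L_n^{(α)}` for an integer index, with the convention `L_n^{(α)} = 0` for `n < 0`. -/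
def laguerre : ℤ → ℂ → ℂ[X]
  | Int.ofNat n, α => laguerreNat n α
  | Int.negSucc _, _ => 0

/-- The generalised Laguerre polynomial
`T_{m,n}^{(μ)}(z) = det [ d^{j+k}/dz^{j+k} L_{m+n}^{(μ+1)}(z) ]_{j,k=0}^{n-1}`
(the empty determinant, `n = 0`, is `1`). The index `m` is an integer because
`T_{m-2,n+1}^{(μ)}` with `m = 1` occurs below. -/
def genLaguerre (m : ℤ) (n : ℕ) (μ : ℂ) : ℂ[X] :=
  (Matrix.of fun j k : Fin n =>
    derivative^[(j : ℕ) + (k : ℕ)] (laguerre (m + n) (μ + 1))).det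

/-- `\hat T_{m,n}^{(μ)}(z) = det [ d^{j+k}/dz^{j+k} L_{m+n}^{(μ+1)}(-z) ]_{j,k=0}^{n-1}`. -/
def genLaguerreHat (m : ℤ) (n : ℕ) (μ : ℂ) : ℂ[X] :=
  (Matrix.of fun j k : Fin n =>
    derivative^[(j : ℕ) + (k : ℕ)] ((laguerre (m + n) (μ + 1)).comp (-X))).det

/-- `w_{m,n}(z;μ) = T_{m-1,n} T_{m-1,n+1} / (T_{m,n} T_{m-2,n+1})`, all at `μ`. -/
def w (m n : ℕ) (μ : ℂ) : RatFunc ℂ :=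
  algebraMap ℂ[X] (RatFunc ℂ) (genLaguerre (m - 1) n μ * genLaguerre (m - 1) (n + 1) μ) /
    algebraMap ℂ[X] (RatFunc ℂ) (genLaguerre m n μ * genLaguerre (m - 2) (n + 1) μ)

/-- `\hat w_{m,n}(z;μ)`: the same quotient with `\hat T` in place of `T`. -/
def wHat (m n : ℕ) (μ : ℂ) : RatFunc ℂ :=
  algebraMap ℂ[X] (RatFunc ℂ)
      (genLaguerreHat (m - 1) n μ * genLaguerreHat (m - 1) (n + 1) μ) /
    algebraMap ℂ[X] (RatFunc ℂ) (genLaguerreHat m n μ * genLaguerreHat (m - 2) (n + 1) μ)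

/-- `f : ℂ → ℂ` satisfies the fifth Painlevé equation with parameters `α, β, γ` and
`δ = -1/2` at the point `z`. -/
def SatisfiesPVAt (α β γ : ℂ) (f : ℂ → ℂ) (z : ℂ) : Prop :=
  deriv (deriv f) z =
    (1 / (2 * f z) + 1 / (f z - 1)) * (deriv f z) ^ 2 - 1 / z * deriv f z
      + (f z - 1) ^ 2 * (α * f z ^ 2 + β) / (z ^ 2 * f z) + γ * f z / z
      - f z * (f z + 1) / (2 * (f z - 1))

/-- The rational function `r` is a solution of the fifth Painlevé equation with parameters
`α, β, γ` and `δ = -1/2`: it is neither of the constants `0` and `1`, at which the equation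
is undefined, and the equation holds at every `z ≠ 0` which is not a pole of `r` and where `r`
does not take the value `0` or `1` (these are all but finitely many points). -/
def IsRationalSolutionPV (α β γ : ℂ) (r : RatFunc ℂ) : Prop :=
  r ≠ 0 ∧ r ≠ 1 ∧
    ∀ z : ℂ, z ≠ 0 → r.denom.eval z ≠ 0 →
      r.eval (RingHom.id ℂ) z ≠ 0 → r.eval (RingHom.id ℂ) z ≠ 1 →
        SatisfiesPVAt α β γ (fun x => r.eval (RingHom.id ℂ) x) z

end PainleveV

end

/-! Put M = m + n - 1, α = μ + 1, f = L_{M+1}^{(α)}, g = L_M^{(α)}, and let τ_n, σ_n be the n × n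
Hankel determinants of the derivatives of f and g. Then w_{m,n} = (τ_{n+1}/τ_n)/(σ_{n+1}/σ_n). Both
sequences satisfy the Toda equation (`hankelDet_toda`), and f, g are linked by two classical
first-order relations (`isLaguerrePair`). For fixed f and g the size n becomes a discrete time. At
each site there are auxiliary c, e factorising the Toda variables of both lattices, together with a
linear relation between c, e, w and a Riccati equation for ze (`IsChainState`). At site 0 these
relations amount to the two Laguerre relations, and one Toda step, which refactorises, preserves
them (`IsChainState.succ`). Eliminating c and e leaves Painlevé V for w (`IsChainState.pvEquation`).
The divisions are legitimate because the Toda equation also controls degrees and leading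
coefficients, so the determinants needed do not vanish (`hankelDet_degree`). For ŵ the same argument
runs with derivation -d/dz and variable -z, which reverses the sign of γ; replacing (n, μ) by (n +
k, -k) then restores the parameters of w. The two solutions differ at infinity: the quotient of
leading coefficients is -1/m for w and 1/m for ŵ (`leadingCoeff_hankelDet`). -/

noncomputable section

namespace PainleveV

/-! ### The derivation d/dX on the fraction field -/

section FractionField

variable (k K : Type*) [Field k] [Field K] [Algebra k[X] K] [IsFractionRing k[X] K]

/-- The quotient rule, applied to a chosen representation of a fraction of polynomials. -/
def fracDeriv (r : K) : K :=
  let p := (IsFractionRing.div_surjective (A := k[X]) r).choose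
  let q := (IsFractionRing.div_surjective (A := k[X]) r).choose_spec.choose
  algebraMap k[X] K (derivative p * q - p * derivative q) / algebraMap k[X] K q ^ 2

variable {k}

/-- Independence of the chosen representation: differentiate the cross-multiplied equality of the
two fractions. -/
theorem fracDeriv_div (p : k[X]) {q : k[X]} (hq : q ≠ 0) :
    fracDeriv k K (algebraMap k[X] K p / algebraMap k[X] K q) =
      algebraMap k[X] K (derivative p * q - p * derivative q) / algebraMap k[X] K q ^ 2 := by
  obtain ⟨p₀, q₀, hq₀, hr, hd⟩ : ∃ p₀ q₀ : k[X], q₀ ≠ 0 ∧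
      algebraMap k[X] K p₀ / algebraMap k[X] K q₀ = algebraMap k[X] K p / algebraMap k[X] K q ∧
      fracDeriv k K (algebraMap k[X] K p / algebraMap k[X] K q) =
        algebraMap k[X] K (derivative p₀ * q₀ - p₀ * derivative q₀) /
          algebraMap k[X] K q₀ ^ 2 := by
    have h := (IsFractionRing.div_surjective (A := k[X])
      (algebraMap k[X] K p / algebraMap k[X] K q)).choose_spec.choose_spec
    exact ⟨_, _, nonZeroDivisors.ne_zero h.1, h.2, rfl⟩
  have inj := IsFractionRing.injective k[X] K
  have e (x : k[X]) (hx : x ≠ 0) : algebraMap k[X] K x ≠ 0 := by simpa using hx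
  rw [hd, div_eq_div_iff (pow_ne_zero 2 (e _ hq₀)) (pow_ne_zero 2 (e _ hq))]
  rw [div_eq_div_iff (e _ hq₀) (e _ hq), ← map_mul, ← map_mul] at hr
  have h := inj hr
  have h' := congrArg derivative h
  simp only [derivative_mul] at h'
  rw [← map_pow, ← map_pow, ← map_mul, ← map_mul]
  congr 1
  linear_combination q₀ * q * h' - (q * derivative q₀ + q₀ * derivative q) * h

variable (k)

/-- The derivation `d/dX` of the field of fractions of the polynomial ring. -/
def fracDerivation : Derivation ℤ K K :=
  Derivation.mk' (AddMonoidHom.toIntLinearMap (AddMonoidHom.mk' (fracDeriv k K) (by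
      intro x y
      obtain ⟨p, q, hq, rfl⟩ := IsFractionRing.div_surjective (A := k[X]) x
      obtain ⟨p', q', hq', rfl⟩ := IsFractionRing.div_surjective (A := k[X]) y
      have hx := nonZeroDivisors.ne_zero hq
      have hy := nonZeroDivisors.ne_zero hq'
      have hx' : algebraMap k[X] K q ≠ 0 := by simpa using hx
      have hy' : algebraMap k[X] K q' ≠ 0 := by simpa using hy
      rw [fracDeriv_div K _ hx, fracDeriv_div K _ hy, div_add_div _ _ hx' hy', ← map_mul,
        ← map_mul, ← map_mul, ← map_add, fracDeriv_div K _ (mul_ne_zero hx hy)]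
      simp only [derivative_mul, map_add, map_mul, map_sub]
      field_simp
      ring)))
    (by
      intro x y
      obtain ⟨p, q, hq, rfl⟩ := IsFractionRing.div_surjective (A := k[X]) x
      obtain ⟨p', q', hq', rfl⟩ := IsFractionRing.div_surjective (A := k[X]) y
      have hx := nonZeroDivisors.ne_zero hq
      have hy := nonZeroDivisors.ne_zero hq'
      have hx' : algebraMap k[X] K q ≠ 0 := by simpa using hx
      have hy' : algebraMap k[X] K q' ≠ 0 := by simpa using hy
      simp only [AddMonoidHom.coe_toIntLinearMap, AddMonoidHom.mk'_apply, smul_eq_mul]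
      rw [div_mul_div_comm, ← map_mul, ← map_mul, fracDeriv_div K _ (mul_ne_zero hx hy),
        fracDeriv_div K _ hx, fracDeriv_div K _ hy]
      simp only [derivative_mul, map_add, map_mul, map_sub]
      field_simp
      ring)

theorem fracDerivation_algebraMap (p : k[X]) :
    fracDerivation k K (algebraMap k[X] K p) = algebraMap k[X] K (derivative p) := by
  have h := fracDeriv_div K p one_ne_zero
  simp only [map_one, div_one, derivative_one, mul_zero, sub_zero, mul_one, one_pow] at h
  exact h

end FractionField

/-! ### Hankel determinants and the Toda equation -/

section

open Matrix

/-- Sylvester's determinant identity for a bordered matrix with two border rows and columns. -/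
theorem det_bordered_two {m K : Type*} [Fintype m] [DecidableEq m] [Field K]
    (A : Matrix m m K) (hA : A.det ≠ 0) (B : Matrix m (Fin 2) K) (C : Matrix (Fin 2) m K)
    (D : Matrix (Fin 2) (Fin 2) K) :
    (fromBlocks A B C D).det * A.det =
      (fromBlocks A (of fun i (_ : Fin 1) => B i 0) (of fun (_ : Fin 1) j => C 0 j)
        (of fun _ _ => D 0 0)).det *
      (fromBlocks A (of fun i (_ : Fin 1) => B i 1) (of fun (_ : Fin 1) j => C 1 j)
        (of fun _ _ => D 1 1)).det -
      (fromBlocks A (of fun i (_ : Fin 1) => B i 1) (of fun (_ : Fin 1) j => C 0 j)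
        (of fun _ _ => D 0 1)).det *
      (fromBlocks A (of fun i (_ : Fin 1) => B i 0) (of fun (_ : Fin 1) j => C 1 j)
        (of fun _ _ => D 1 0)).det := by
  have : Invertible A := A.invertibleOfIsUnitDet hA.isUnit
  -- After division by det A, each singly bordered determinant is an entry of the 2 × 2 Schur
  -- complement D - C A⁻¹ B, and the doubly bordered one is its determinant.
  simp only [det_fromBlocks₁₁, det_fin_two, det_unique]
  simp only [Matrix.sub_apply, of_apply, mul_apply]
  ring

/-- The Hankel determinant `det [d^{j+k} f]` with the last row shifted by `r` and
the last column shifted by `s`. -/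
def shiftedHankel (f : ℂ[X]) (n r s : ℕ) : ℂ[X] :=
  (of fun j k : Fin (n + 1) =>
    derivative^[(j + if (j : ℕ) = n then r else 0) + (k + if (k : ℕ) = n then s else 0)] f).det

/-- The Hankel determinant `det [d^{j+k} f]`. -/
def hankelDet (f : ℂ[X]) (n : ℕ) : ℂ[X] :=
  (of fun j k : Fin n => derivative^[(j : ℕ) + (k : ℕ)] f).det

theorem derivative_det {n : ℕ} (M : Matrix (Fin n) (Fin n) ℂ[X]) :
    derivative M.det = ∑ i, (M.updateCol i fun j => derivative (M j i)).det := by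
  simp only [det_apply', derivative_sum, ← C_eq_intCast, derivative_C_mul]
  rw [Finset.sum_comm]
  refine Finset.sum_congr rfl fun σ _ => ?_
  rw [derivative_prod_finset, Finset.mul_sum]
  refine Finset.sum_congr rfl fun i _ => ?_
  rw [← Finset.prod_erase_mul Finset.univ _ (Finset.mem_univ i), updateCol_self]
  congr 2
  refine Finset.prod_congr rfl fun k hk => ?_
  rw [updateCol_ne (Finset.ne_of_mem_erase hk)]

theorem shiftedHankel_comm (f : ℂ[X]) (n r s : ℕ) :
    shiftedHankel f n r s = shiftedHankel f n s r := by
  unfold shiftedHankel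
  rw [← det_transpose]
  congr 1
  ext1 j k
  simp only [transpose_apply, of_apply]
  rw [add_comm]

/-- Differentiate column by column. Differentiating any column except the last reproduces its right
neighbour, so only the last column contributes. A shift of the last row does not disturb this. -/
theorem derivative_shiftedHankel (f : ℂ[X]) (n r : ℕ) :
    derivative (shiftedHankel f n r 0) = shiftedHankel f n r 1 := by
  unfold shiftedHankel
  rw [derivative_det, Finset.sum_eq_single (Fin.last n)]
  · congr 1
    ext1 j k
    rcases eq_or_ne k (Fin.last n) with rfl | hk
    · rw [updateCol_self]
      simp only [of_apply, Fin.val_last, if_true]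
      rw [← Function.iterate_succ_apply' derivative]
      rfl
    · have : (k : ℕ) ≠ n := fun h => hk (Fin.ext h)
      rw [updateCol_ne hk]
      simp [this]
  · intro k _ hk
    have hkn : (k : ℕ) < n := lt_of_le_of_ne (Nat.lt_succ_iff.1 k.2) fun h => hk (Fin.ext h)
    have hne : k ≠ ⟨k + 1, by omega⟩ := fun h => by
      have := congrArg Fin.val h
      simp at this
    refine det_zero_of_column_eq hne fun j => ?_
    rw [updateCol_self, updateCol_ne hne.symm]
    simp only [of_apply, ite_self, add_zero]
    rw [← Function.iterate_succ_apply' derivative]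
    rfl
  · simp

theorem shiftedHankel_zero_zero (f : ℂ[X]) (n : ℕ) :
    shiftedHankel f n 0 0 = hankelDet f (n + 1) := by
  simp [shiftedHankel, hankelDet]

/-- The Toda equation for Hankel determinants of derivatives. -/
theorem hankelDet_toda (f : ℂ[X]) (n : ℕ) (h : hankelDet f n ≠ 0) :
    hankelDet f (n + 2) * hankelDet f n =
      hankelDet f (n + 1) * derivative (derivative (hankelDet f (n + 1))) -
        derivative (hankelDet f (n + 1)) ^ 2 := by
  have e1 : derivative (hankelDet f (n + 1)) = shiftedHankel f n 1 0 := by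
    rw [← shiftedHankel_zero_zero, derivative_shiftedHankel, shiftedHankel_comm]
  rw [e1, derivative_shiftedHankel, ← shiftedHankel_zero_zero f n]
  let φ : ℂ[X] →+* FractionRing ℂ[X] := algebraMap _ _
  have inj : Function.Injective φ := IsFractionRing.injective _ _
  let G (j k : ℕ) : FractionRing ℂ[X] := φ (derivative^[j + k] f)
  -- The Hankel matrix of size n + 2 is its n × n corner A with two border rows and columns; keeping
  -- one border row and one border column gives the shifted determinants of size n + 1.
  let A : Matrix (Fin n) (Fin n) (FractionRing ℂ[X]) := of fun j k => G j k
  let B : Matrix (Fin n) (Fin 2) (FractionRing ℂ[X]) := of fun j k => G j (n + k)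
  let C : Matrix (Fin 2) (Fin n) (FractionRing ℂ[X]) := of fun j k => G (n + j) k
  let D : Matrix (Fin 2) (Fin 2) (FractionRing ℂ[X]) := of fun j k => G (n + j) (n + k)
  have hA : φ (hankelDet f n) = A.det := by
    rw [hankelDet, RingHom.map_det]
    rfl
  have h2 : φ (hankelDet f (n + 2)) = (fromBlocks A B C D).det := by
    rw [hankelDet, RingHom.map_det, ← det_submatrix_equiv_self finSumFinEquiv]
    congr 1
    ext1 (j | j) (k | k) <;> simp [A, B, C, D, G]
  have h1 (r s : Fin 2) : φ (shiftedHankel f n r s) =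
      (fromBlocks A (of fun i (_ : Fin 1) => B i s) (of fun (_ : Fin 1) j => C r j)
        (of fun _ _ => D r s)).det := by
    rw [shiftedHankel, RingHom.map_det, ← det_submatrix_equiv_self finSumFinEquiv]
    congr 1
    ext1 (j | j) (k | k) <;>
      simp [A, B, C, D, G, Nat.ne_of_lt]
  have h3 := det_bordered_two A (by rw [← hA]; exact fun h' => h (inj (by rw [h', map_zero]))) B C D
  rw [← hA, ← h2, ← h1, ← h1, ← h1, ← h1, ← map_mul, ← map_mul, ← map_mul, ← map_sub] at h3
  have h4 := inj h3
  simp only [Fin.val_zero, Fin.val_one] at h4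
  rw [h4, shiftedHankel_comm f n 0 1, sq]

end

/-! ### One Toda step for the linked pair of lattices -/

section

variable {K : Type*} [Field K]

/-- The relations satisfied, at one site `n`, by two Toda lattices `(a, u)` and `(b, v)` linked by
Darboux transformations with parameters `c`, `e`; `w` is the quotient of their tau function ratios.
The last two relations make `w` a solution of the fifth Painlevé equation. -/
structure IsChainState (δ : Derivation ℤ K K) (z α N n a b u v w c e : K) : Prop where
  w_ne_zero : w ≠ 0
  deriv_w : δ w = w * (a - b)
  a_eq : a = c + e
  b_eq : b = 1 + w * c + e / w
  u_eq : u = e * c - δ e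
  v_eq : v = e * c - δ (e / w)
  linear : z * (c * w + e) = (N - n) * w - (N + n + α)
  riccati : z * δ (z * e) = (w - 1) * (z * e) * (z * e + (N + n + α)) / w
      - z * w * (z * e + n) / (w - 1)

namespace IsChainState

variable {δ : Derivation ℤ K K} {z α N n a b u v w c e a₁ b₁ u₁ v₁ w₁ e₁ : K}

/-- At w = 1 the two factorisations give a - b = -1, whereas δ w = 0. -/
theorem w_ne_one (h : IsChainState δ z α N n a b u v w c e) : w ≠ 1 := by
  intro hw
  have h1 := h.deriv_w
  rw [h.a_eq, h.b_eq, hw] at h1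
  simp at h1

theorem deriv_w_eq (h : IsChainState δ z α N n a b u v w c e) :
    z * δ w = (w - 1) * (2 * (z * e) - (N - n) * w + (N + n + α)) - z * w := by
  have h1 := h.linear
  have h0 := h.w_ne_zero
  rw [h.deriv_w, h.a_eq, h.b_eq]
  have : z * (w * (c + e - (1 + w * c + e / w))) = z * ((w-1)*(e - c*w) - w) := by
    field_simp
    ring
  rw [this]
  linear_combination (-(w-1)) * h1

/-- Differentiating `linear` and eliminating δ w and δ e by `deriv_w_eq` and `riccati` determines e
+ δ c / c rationally in w and c. This quantity is the parameter e of the next site. -/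
theorem deriv_c (h : IsChainState δ z α N n a b u v w c e) (hz : z ≠ 0) (hδz : δ z = 1)
    (hα : δ α = 0) (hN : δ N = 0) (hn : δ n = 0) (hc : c ≠ 0) :
    z * c * (z * (e + δ c / c)) * (w - 1) =
      -(z * c * (z * c + 2 * n + α + 1) * (w - 1)) - z * (z * c + n + α) := by
  have h0 := h.w_ne_zero
  have h1 : w - 1 ≠ 0 := sub_ne_zero.2 h.w_ne_one
  have hl := congrArg δ h.linear
  have hy := h.riccati
  have hw := h.deriv_w_eq
  have hl0 := h.linear
  simp only [Derivation.leibniz, map_add, map_sub, smul_eq_mul, hδz, hα, hN, hn] at hl hy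
  obtain ⟨y, rfl⟩ : ∃ y, e = y / z := ⟨z * e, by field_simp⟩
  obtain ⟨t, rfl⟩ : ∃ t, c = t / z := ⟨z * c, by field_simp⟩
  have ht : t ≠ 0 := by rintro rfl; simp at hc
  have hs : N + n + α = (N - n) * w - t * w - y := by
    field_simp at hl0
    linear_combination hl0
  rw [hs] at hw hy
  generalize δ (y / z) = dy at *
  generalize δ (t / z) = dc at *
  have e1 : α = (N - n) * w - t * w - y - N - n := by linear_combination hs
  subst e1
  have e2 : δ w = ((w - 1) * (2 * (z * (y / z)) - (N - n) * w + ((N - n) * w - t * w - y)) - z * w) / z := by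
    rw [← hw]; field_simp
  have e3 : dy = ((w - 1) * (z * (y / z)) * (z * (y / z) + ((N - n) * w - t * w - y)) / w -
    z * w * (z * (y / z) + n) / (w - 1) - y) / z ^ 2 := by
    rw [← hy]; field_simp; ring
  have e4 : dc = ((N - n) * δ w - (t / z * w + y / z) - z * (t / z * δ w) - z * dy) / (z * w) := by
    field_simp
    field_simp at hl
    linear_combination hl
  rw [e4, e3, e2]
  field_simp
  ring

/-- Obtained by differentiating `deriv_c`; both `linear` and `riccati` at the next site come from
it. -/
theorem deriv_succ (h : IsChainState δ z α N n a b u v w c e) (hz : z ≠ 0) (hδz : δ z = 1)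
    (hα : δ α = 0) (hN : δ N = 0) (hn : δ n = 0) (hc : c ≠ 0) (he₁ : δ c = c * (e₁ - e)) :
    z * δ (z * e₁) = (N - n) * (z * e₁) - z * c * (z * e₁)
      - (N + n + α + 1 + z * e₁) * (z * e₁ - z - (w - 1) * (z * c)) := by
  have h0 := h.w_ne_zero
  have h1 : w - 1 ≠ 0 := sub_ne_zero.2 h.w_ne_one
  have hF := h.deriv_c hz hδz hα hN hn hc
  have he : e + δ c / c = e₁ := by rw [he₁]; field_simp; ring
  rw [he] at hF
  have hdF := congrArg δ hF
  have hw := h.deriv_w_eq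
  have hl := h.linear
  have h2 : δ (2 : K) = 0 := by simpa using δ.map_natCast 2
  simp only [Derivation.leibniz, map_add, map_sub, map_neg, smul_eq_mul, hδz, hα, hn, he₁,
    Derivation.map_one_eq_zero, h2] at hdF ⊢
  obtain ⟨y, rfl⟩ : ∃ y, e = y / z := ⟨z * e, by field_simp⟩
  obtain ⟨t, rfl⟩ : ∃ t, c = t / z := ⟨z * c, by field_simp⟩
  have ht : t ≠ 0 := by rintro rfl; simp at hc
  have hs : y = (N - n) * w - t * w - (N + n + α) := by
    field_simp at hl
    linear_combination hl
  subst hs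
  have e2 : δ w = ((w - 1) * (2 * ((N - n) * w - t * w - (N + n + α)) - (N - n) * w + (N + n + α)) - z * w) / z := by
    have : z * δ w / z = δ w := by field_simp
    rw [← this, hw]; field_simp
  rw [e2] at hdF
  have e3 : e₁ = (-(t * (t + 2 * n + α + 1) * (w - 1)) - z * (t + n + α)) / (t * (w - 1) * z) := by
    field_simp at hF ⊢
    linear_combination hF
  generalize δ e₁ = d at *
  subst e3
  field_simp at hdF ⊢
  linear_combination hdF

/-- A Darboux step exchanges the factors: u = ec - δ e turns into u₁ = u + δ a = ec + δ c, which is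
written e₁ c. The second lattice is treated alike, with wc and e/w in place of c and e. -/
theorem succ (h : IsChainState δ z α N n a b u v w c e) (hz : z ≠ 0) (hδz : δ z = 1)
    (hα : δ α = 0) (hN : δ N = 0) (hn : δ n = 0) (hu₁ : u₁ = u + δ a) (hv₁ : v₁ = v + δ b)
    (hdu₁ : δ u₁ = u₁ * (a₁ - a)) (hdv₁ : δ v₁ = v₁ * (b₁ - b)) (hw₁ : w₁ = w * u₁ / v₁)
    (hu₁0 : u₁ ≠ 0) (hv₁0 : v₁ ≠ 0) :
    ∃ c₁ e₁, IsChainState δ z α N (n + 1) a₁ b₁ u₁ v₁ w₁ c₁ e₁ := by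
  have h0 := h.w_ne_zero
  have h1 : w - 1 ≠ 0 := sub_ne_zero.2 h.w_ne_one
  have hu : u₁ = e * c + δ c := by rw [hu₁, h.u_eq, h.a_eq, map_add]; ring
  have hc : c ≠ 0 := by rintro rfl; simp at hu; exact hu₁0 hu
  have hw : δ w = (w - 1) * (e - c * w) - w := by
    rw [h.deriv_w, h.a_eq, h.b_eq]; field_simp; ring
  obtain ⟨e₁, rfl⟩ : ∃ e₁, u₁ = e₁ * c := ⟨u₁ / c, by field_simp⟩
  have he₁0 : e₁ ≠ 0 := left_ne_zero_of_mul hu₁0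
  have hdc : δ c = c * (e₁ - e) := by linear_combination -hu
  have hv : v₁ = w * c * (e₁ - 1 - (w - 1) * c) := by
    rw [hv₁, h.v_eq, h.b_eq]
    simp only [map_add, Derivation.leibniz _ w c, smul_eq_mul, Derivation.map_one_eq_zero, hdc, hw]
    ring
  -- E is the future e₁ / w₁, the second lattice's counterpart of e₁.
  obtain ⟨E, hE⟩ : ∃ E, E = e₁ - 1 - (w - 1) * c := ⟨_, rfl⟩
  rw [← hE] at hv
  have hE0 : E ≠ 0 := by rintro rfl; simp [hv] at hv₁0
  have hwE : w₁ = e₁ / E := by rw [hw₁, hv]; field_simp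
  have hdE : δ E = δ e₁ - (((w - 1) * (e - c * w) - w) * c + (w - 1) * (c * (e₁ - e))) := by
    rw [hE]; simp [hw, hdc]; ring
  have ha₁ : a₁ = c + e₁ + δ e₁ / e₁ := by
    rw [Derivation.leibniz, smul_eq_mul, smul_eq_mul, hdc, h.a_eq] at hdu₁
    field_simp
    refine mul_left_cancel₀ hc ?_
    linear_combination -hdu₁
  have hb₁ : b₁ = 1 + w * c + E + δ E / E := by
    rw [hv, Derivation.leibniz, Derivation.leibniz, h.b_eq] at hdv₁
    simp only [smul_eq_mul, hdc, hw] at hdv₁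
    field_simp at hdv₁ ⊢
    refine mul_left_cancel₀ h0 ?_
    linear_combination -hdv₁ - w * E * hE
  have hkey := h.deriv_succ hz hδz hα hN hn hc hdc
  have hF := h.deriv_c hz hδz hα hN hn hc
  have he : e + δ c / c = e₁ := by rw [hdc]; field_simp; ring
  rw [he] at hF
  have hw₁0 : w₁ ≠ 0 := by rw [hwE]; exact div_ne_zero he₁0 hE0
  have hcw : w₁ * (c + δ e₁ / e₁) = w * c + δ E / E := by
    rw [hwE, hdE]
    field_simp
    linear_combination -w * c * hE
  have hdw₁ : δ w₁ = w₁ * (a₁ - b₁) := by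
    rw [hw₁, Derivation.leibniz_div]
    simp only [Derivation.leibniz, smul_eq_mul, hdv₁, h.deriv_w]
    have hdu₁' := hdu₁
    simp only [Derivation.leibniz, smul_eq_mul] at hdu₁'
    rw [hdu₁']
    field_simp
    ring
  have heE : e₁ / w₁ = E := by rw [hwE]; field_simp
  have hne : w₁ ≠ 1 := by
    intro hw1
    have h2 := hdw₁
    rw [ha₁, hb₁] at h2
    rw [hw1] at h2 hcw heE
    rw [Derivation.map_one_eq_zero] at h2
    refine one_ne_zero (α := K) ?_
    linear_combination h2 + hcw + heE
  -- The first witness is forced by a₁ = c₁ + e₁.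
  refine ⟨c + δ e₁ / e₁, e₁, hw₁0, hdw₁, ?_, ?_, ?_, ?_, ?_, ?_⟩
  · rw [ha₁]; ring
  · rw [hb₁, hcw, heE]; ring
  · field_simp; ring
  · rw [heE, hv, hdE]
    field_simp
    rw [hE]
    ring
  · rw [hwE]
    simp only [Derivation.leibniz, smul_eq_mul, hδz] at hkey
    field_simp
    refine mul_left_cancel₀ hz ?_
    linear_combination hkey + (N + n + α + 1 + z * e₁) * z * hE
  · have hD : w₁ - 1 = (1 + (w - 1) * c) / E := by 
      rw [hwE]
      field_simp
      linear_combination -hE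
    have hD0 : 1 + (w - 1) * c ≠ 0 := by
      intro h2
      rw [h2, zero_div] at hD
      exact hne (sub_eq_zero.1 hD)
    have e3 : e₁ = (-(z * c * (z * c + 2 * n + α + 1) * (w - 1)) - z * (z * c + n + α)) /
        (z * c * z * (w - 1)) := by
      field_simp at hF ⊢
      linear_combination hF
    have e4 : (w₁ - 1) * (z * e₁) * (z * e₁ + (N + (n + 1) + α)) / w₁ =
        (1 + (w - 1) * c) * z * (z * e₁ + (N + (n + 1) + α)) := by
      rw [hD, hwE]; field_simp
    have e5 : z * w₁ * (z * e₁ + (n + 1)) / (w₁ - 1) =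
        z * e₁ * (z * e₁ + (n + 1)) / (1 + (w - 1) * c) := by
      rw [hD, hwE]; field_simp
    rw [hkey, e4, e5]
    -- Once e₁ is replaced by its expression in c and w, the Riccati equation is a rational
    -- identity.
    clear e4 e5 hD hdE hcw hb₁ ha₁ hkey hF he hdc hv hwE heE hE hdv₁ hdu₁ hu hv₁ hu₁
    subst e3
    have hD0' : 1 + c * (w - 1) ≠ 0 := by rwa [mul_comm c]
    field_simp
    ring

end IsChainState

end

/-! ### Painlevé V from the chain relations -/

section

variable {K : Type*} [Field K]

/-- The fifth Painlevé equation with `δ = -1/2` in a field with derivation `δ`, the independent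
variable being `z`. -/
def PVEquation (δ : Derivation ℤ K K) (z α β γ w : K) : Prop :=
  δ (δ w) = (1 / (2 * w) + 1 / (w - 1)) * δ w ^ 2 - 1 / z * δ w
    + (w - 1) ^ 2 * (α * w ^ 2 + β) / (z ^ 2 * w) + γ * w / z - w * (w + 1) / (2 * (w - 1))

/-- With y = ze, `deriv_w_eq` and `riccati` form a first-order system for (w, y). Since y enters the
first equation linearly, differentiating that equation and eliminating y gives the second-order
equation. -/
theorem IsChainState.pvEquation [CharZero K] {δ : Derivation ℤ K K}
    {z α N n a b u v w c e : K} (h : IsChainState δ z α N n a b u v w c e) (hz : z ≠ 0)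
    (hδz : δ z = 1) (hα : δ α = 0) (hN : δ N = 0) (hn : δ n = 0) :
    PVEquation δ z ((N - n) ^ 2 / 2) (-((N + n + α) ^ 2 / 2)) (α - 1) w := by
  have h0 := h.w_ne_zero
  have h1 : w - 1 ≠ 0 := sub_ne_zero.2 h.w_ne_one
  have hw := h.deriv_w_eq
  have hd := congrArg δ hw
  have hy := h.riccati
  generalize z * e = y at hw hd hy
  have h2 : δ (2 : K) = 0 := by simpa using δ.map_natCast 2
  simp only [Derivation.leibniz, map_add, map_sub, smul_eq_mul, hδz, hα, hN, hn, h2,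
    Derivation.map_one_eq_zero] at hd
  unfold PVEquation
  have e0 : δ y = ((w - 1) * y * (y + (N + n + α)) / w - z * w * (y + n) / (w - 1)) / z := by
    rw [← hy]; field_simp
  have e1 : δ w = ((w - 1) * (2 * y - (N - n) * w + (N + n + α)) - z * w) / z := by
    rw [← hw]; field_simp
  have e2 : δ (δ w) = ((w - 1) * (2 * δ y - (N - n) * δ w)
      + (2 * y - (N - n) * w + (N + n + α)) * δ w - z * δ w - w - δ w) / z := by
    field_simp
    linear_combination hd
  rw [e2, e0, e1]
  field_simp
  ring

section Chain

variable {δ : Derivation ℤ K K} {z α : K} {M : ℕ} {τ σ : ℕ → K}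

/-- The Toda equation in logarithmic form, (log t)'' = xy/t², followed by its logarithmic
derivative. -/
theorem deriv_toda {x y t : K} (hx : x ≠ 0) (hy : y ≠ 0) (ht : t ≠ 0)
    (h : x * y = t * δ (δ t) - δ t ^ 2) :
    δ (δ t / t) = x * y / t ^ 2 ∧
      δ (δ (δ t / t)) = δ (δ t / t) * (δ x / x - δ t / t - (δ t / t - δ y / y)) := by
  have h1 : δ (δ t / t) = x * y / t ^ 2 := by
    rw [Derivation.leibniz_div, h]
    simp only [smul_eq_mul]
    field_simp
  refine ⟨h1, ?_⟩
  rw [h1, Derivation.leibniz_div]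
  simp only [Derivation.leibniz, Derivation.leibniz_pow, smul_eq_mul, nsmul_eq_mul]
  field_simp
  push_cast
  ring

theorem exists_isChainState (hz : z ≠ 0) (hδz : δ z = 1) (hα : δ α = 0)
    (hτ : ∀ n ≤ M + 2, τ n ≠ 0) (hσ : ∀ n ≤ M + 1, σ n ≠ 0) (hτ0 : τ 0 = 1) (hσ0 : σ 0 = 1)
    (hτt : ∀ n ≤ M, τ (n + 2) * τ n = τ (n + 1) * δ (δ (τ (n + 1))) - δ (τ (n + 1)) ^ 2)
    (hσt : ∀ n < M, σ (n + 2) * σ n = σ (n + 1) * δ (δ (σ (n + 1))) - δ (σ (n + 1)) ^ 2)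
    (h1 : δ (τ 1) = δ (σ 1) - σ 1)
    (h2 : z * δ (τ 1) = (M + 1) * τ 1 - (M + 1 + α) * σ 1) (n : ℕ) (hn : n ≤ M) :
    ∃ c e, IsChainState δ z α (M + 1) n
      (δ (τ (n + 1)) / τ (n + 1) - δ (τ n) / τ n) (δ (σ (n + 1)) / σ (n + 1) - δ (σ n) / σ n)
      (δ (δ (τ n) / τ n)) (δ (δ (σ n) / σ n)) (σ n * τ (n + 1) / (τ n * σ (n + 1))) c e := by
  induction n with
  | zero =>
    have hτ1 := hτ 1 (by omega)
    have hσ1 := hσ 1 (by omega)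
    -- As τ 0 = σ 0 = 1, both u and v vanish, which e = 0 satisfies. Then `b_eq` is `h1`, `linear`
    -- is `h2`, and `riccati` reads 0 = 0.
    refine ⟨δ (τ 1) / τ 1, 0, ?_, ?_, ?_, ?_, ?_, ?_, ?_, ?_⟩
    · simp [hτ0, hσ0, hτ1, hσ1]
    · simp only [hτ0, hσ0, zero_add, Derivation.leibniz_div, one_mul, Derivation.map_one_eq_zero,
        smul_eq_mul]
      field_simp
      ring
    · simp [hτ0]
    · simp only [hτ0, hσ0, zero_add, one_mul, Derivation.map_one_eq_zero]
      field_simp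
      rw [h1]
      ring
    · simp [hτ0]
    · simp [hσ0]
    · simp only [hτ0, hσ0, zero_add, one_mul, Nat.cast_zero]
      field_simp
      linear_combination h2
    · simp
  | succ n ih =>
    obtain ⟨c, e, h⟩ := ih (by omega)
    have A := deriv_toda (hτ _ (by omega)) (hτ _ (by omega)) (hτ _ (by omega)) (hτt n (by omega))
    have B := deriv_toda (hσ _ (by omega)) (hσ _ (by omega)) (hσ _ (by omega)) (hσt n (by omega))
    have t0 := hτ n (by omega)
    have t1 := hτ (n + 1) (by omega)
    have t2 := hτ (n + 2) (by omega)
    have s0 := hσ n (by omega)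
    have s1 := hσ (n + 1) (by omega)
    have s2 := hσ (n + 2) (by omega)
    rw [Nat.cast_succ]
    refine h.succ hz hδz hα (by simp) (by simp) (by rw [map_sub]; ring) (by rw [map_sub]; ring)
      A.2 B.2 ?_ ?_ ?_
    · rw [A.1, B.1]
      field_simp
    · rw [A.1]
      exact div_ne_zero (mul_ne_zero t2 t0) (pow_ne_zero _ t1)
    · rw [B.1]
      exact div_ne_zero (mul_ne_zero s2 s0) (pow_ne_zero _ s1)

end Chain

end

/-! ### From the equation in the fraction field to the equation at points -/

/-- A polynomial identity can be evaluated at any point, so the cleared form of the equation carries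
it from the formal derivation to complex derivatives. -/
theorem polynomial_identity_of_pvEquation {k K : Type*} [Field k] [CharZero k] [Field K]
    [Algebra k[X] K] [IsFractionRing k[X] K] {p q : k[X]} (hp : p ≠ 0) (hq : q ≠ 0) (hpq : p ≠ q)
    {α β γ : k}
    (h : PVEquation (fracDerivation k K) (algebraMap k[X] K X) (algebraMap k[X] K (C α))
      (algebraMap k[X] K (C β)) (algebraMap k[X] K (C γ))
      (algebraMap k[X] K p / algebraMap k[X] K q))
    {W : k[X]} (hW : W = derivative p * q - p * derivative q) :
    2 * X ^ 2 * p * (p - q) * (derivative W * q - 2 * W * derivative q) =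
      X ^ 2 * (3 * p - q) * W ^ 2 - 2 * X * p * (p - q) * q * W
        + 2 * (p - q) ^ 3 * (C α * p ^ 2 + C β * q ^ 2) + 2 * C γ * X * p ^ 2 * (p - q) * q ^ 2
        - X ^ 2 * p ^ 2 * (p + q) * q ^ 2 := by
  have inj := IsFractionRing.injective k[X] K
  have e (x : k[X]) (hx : x ≠ 0) : algebraMap k[X] K x ≠ 0 := by simpa using hx
  have hX := e X X_ne_zero
  have hp' := e _ hp
  have hq' := e _ hq
  have hpq' := e _ (sub_ne_zero.2 hpq)
  rw [map_sub] at hpq'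
  have h2 : (2 : K) ≠ 0 := by
    rw [← map_ofNat (algebraMap k[X] K) 2]
    exact e _ two_ne_zero
  have d1 : fracDerivation k K (algebraMap k[X] K p / algebraMap k[X] K q) =
      algebraMap k[X] K W / algebraMap k[X] K q ^ 2 := by
    rw [Derivation.leibniz_div, fracDerivation_algebraMap, fracDerivation_algebraMap, hW]
    simp only [smul_eq_mul, map_sub, map_mul]
    field_simp
  have d2 : fracDerivation k K (algebraMap k[X] K W / algebraMap k[X] K q ^ 2) =
      (algebraMap k[X] K (derivative W) * algebraMap k[X] K q -
        2 * algebraMap k[X] K W * algebraMap k[X] K (derivative q)) / algebraMap k[X] K q ^ 3 := by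
    rw [Derivation.leibniz_div, Derivation.leibniz_pow, fracDerivation_algebraMap,
      fracDerivation_algebraMap]
    simp only [smul_eq_mul, nsmul_eq_mul]
    push_cast
    field_simp
  unfold PVEquation at h
  rw [d1, d2] at h
  have h1 : algebraMap k[X] K p / algebraMap k[X] K q - 1 =
    (algebraMap k[X] K p - algebraMap k[X] K q) / algebraMap k[X] K q := by field_simp
  rw [h1] at h
  apply inj
  simp only [map_mul, map_sub, map_add, map_pow, map_ofNat]
  field_simp at h
  linear_combination h

theorem satisfiesPVAt_of_polynomial_identity {p q W : ℂ[X]} {α β γ z : ℂ}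
    (hW : W = derivative p * q - p * derivative q)
    (h : 2 * X ^ 2 * p * (p - q) * (derivative W * q - 2 * W * derivative q) =
      X ^ 2 * (3 * p - q) * W ^ 2 - 2 * X * p * (p - q) * q * W
        + 2 * (p - q) ^ 3 * (C α * p ^ 2 + C β * q ^ 2) + 2 * C γ * X * p ^ 2 * (p - q) * q ^ 2
        - X ^ 2 * p ^ 2 * (p + q) * q ^ 2)
    (hz : z ≠ 0) (hq : q.eval z ≠ 0) (hp : p.eval z ≠ 0) (hpq : p.eval z - q.eval z ≠ 0) :
    SatisfiesPVAt α β γ (fun x => p.eval x / q.eval x) z := by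
  have d1 (x : ℂ) (hx : q.eval x ≠ 0) :
      deriv (fun x => p.eval x / q.eval x) x = W.eval x / q.eval x ^ 2 := by
    rw [((p.hasDerivAt x).fun_div (q.hasDerivAt x) hx).deriv, hW]
    simp
  have ev : ∀ᶠ x in nhds z, q.eval x ≠ 0 := q.continuous.continuousAt.eventually_ne hq
  have d2 : deriv (deriv (fun x => p.eval x / q.eval x)) z =
      ((derivative W).eval z * q.eval z - 2 * W.eval z * (derivative q).eval z)
        / q.eval z ^ 3 := by
    have : deriv (fun x => p.eval x / q.eval x) =ᶠ[nhds z] fun x => W.eval x / q.eval x ^ 2 := by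
      filter_upwards [ev] with x hx using d1 x hx
    rw [this.deriv_eq,
      ((W.hasDerivAt z).fun_div ((q.hasDerivAt z).fun_pow 2) (pow_ne_zero 2 hq)).deriv]
    push_cast
    field_simp
  have he := congrArg (eval z) h
  simp only [eval_mul, eval_add, eval_sub, eval_pow, eval_X, eval_C, eval_ofNat] at he
  unfold SatisfiesPVAt
  have h1 : p.eval z / q.eval z - 1 = (p.eval z - q.eval z) / q.eval z := by field_simp
  rw [d1 z hq, d2]
  simp only [h1]
  field_simp
  linear_combination he

theorem isRationalSolutionPV_of_pvEquation {α β γ : ℂ} {r : RatFunc ℂ} (h0 : r ≠ 0) (h1 : r ≠ 1)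
    (h : PVEquation (fracDerivation ℂ (RatFunc ℂ)) (algebraMap ℂ[X] (RatFunc ℂ) X)
      (algebraMap ℂ[X] (RatFunc ℂ) (C α)) (algebraMap ℂ[X] (RatFunc ℂ) (C β))
      (algebraMap ℂ[X] (RatFunc ℂ) (C γ)) r) :
    IsRationalSolutionPV α β γ r := by
  refine ⟨h0, h1, fun z hz hd hr0 hr1 => ?_⟩
  have hp : r.num ≠ 0 := RatFunc.num_ne_zero h0
  have hpq : r.num ≠ r.denom := by
    intro h2
    apply h1
    rw [← r.num_div_denom, h2, div_self]
    exact RatFunc.algebraMap_ne_zero r.denom_ne_zero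
  rw [← r.num_div_denom] at h
  have key := satisfiesPVAt_of_polynomial_identity (z := z) rfl
    (polynomial_identity_of_pvEquation hp r.denom_ne_zero hpq h rfl) hz hd
  simp only [RatFunc.eval, eval₂_id] at hr0 hr1 ⊢
  refine key (left_ne_zero_of_mul (by simpa [div_eq_mul_inv] using hr0)) fun h2 => hr1 ?_
  rw [sub_eq_zero.1 h2, div_self hd]

/-! ### Degrees and leading coefficients of Hankel determinants -/

section

theorem hankelDet_zero (f : ℂ[X]) : hankelDet f 0 = 1 := by simp [hankelDet]

theorem hankelDet_one (f : ℂ[X]) : hankelDet f 1 = f := by simp [hankelDet]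

/-- In terms of the Euler operator θ = X d/dX, which multiplies the k-th coefficient by k, the
expression is t(θ²t - θt) - (θt)². With d = deg t, its coefficient in degree 2d carries the factor
d(d - 1) - d² = -d. -/
theorem coeff_X_sq_mul_toda (t : ℂ[X]) :
    (X ^ 2 * (t * derivative (derivative t) - derivative t ^ 2)).natDegree ≤ 2 * t.natDegree ∧
      (X ^ 2 * (t * derivative (derivative t) - derivative t ^ 2)).coeff (2 * t.natDegree) =
        -(t.natDegree * t.leadingCoeff ^ 2) := by
  have h1 (p : ℂ[X]) (k : ℕ) : (X * derivative p).coeff k = k * p.coeff k := by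
    cases k with
    | zero => simp
    | succ k => rw [coeff_X_mul, coeff_derivative]; push_cast; ring
  have e : X ^ 2 * (t * derivative (derivative t) - derivative t ^ 2) =
      t * (X * derivative (X * derivative t) - X * derivative t) -
        (X * derivative t) * (X * derivative t) := by
    simp only [derivative_mul, derivative_X]
    ring
  have d1 : (X * derivative t).natDegree ≤ t.natDegree := by
    rw [natDegree_le_iff_coeff_eq_zero]
    intro k hk
    rw [h1, coeff_eq_zero_of_natDegree_lt hk, mul_zero]
  have d2 : (X * derivative (X * derivative t) - X * derivative t).natDegree ≤ t.natDegree := by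
    rw [natDegree_le_iff_coeff_eq_zero]
    intro k hk
    rw [coeff_sub, h1, h1, coeff_eq_zero_of_natDegree_lt hk]
    simp
  rw [e]
  constructor
  · refine (natDegree_sub_le _ _).trans (max_le ?_ ?_) <;> rw [two_mul]
    · exact natDegree_mul_le_of_le le_rfl d2
    · exact natDegree_mul_le_of_le d1 d1
  · rw [two_mul, coeff_sub, coeff_mul_add_eq_of_natDegree_le le_rfl d2, coeff_mul_add_eq_of_natDegree_le d1 d1,
      coeff_sub, h1, h1, coeff_natDegree]
    ring

/-- For n < N the degree (n + 1)(N - n) is positive, so the top coefficient of the Toda right-hand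
side survives and fixes the next determinant's degree and leading coefficient. -/
theorem hankelDet_degree_step {f : ℂ[X]} {N n : ℕ} (hn : n + 1 ≤ N) (h0 : hankelDet f n ≠ 0)
    (h1 : hankelDet f (n + 1) ≠ 0) (d0 : (hankelDet f n).natDegree = n * (N + 1 - n))
    (d1 : (hankelDet f (n + 1)).natDegree = (n + 1) * (N - n)) :
    hankelDet f (n + 2) ≠ 0 ∧ (hankelDet f (n + 2)).natDegree = (n + 2) * (N - (n + 1)) ∧
      (hankelDet f (n + 2)).leadingCoeff * (hankelDet f n).leadingCoeff =
        -(((n + 1) * (N - n) : ℂ) * (hankelDet f (n + 1)).leadingCoeff ^ 2) := by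
  obtain ⟨r, rfl⟩ := Nat.exists_eq_add_of_le hn
  have e1 : n + 1 + r - n = r + 1 := by omega
  have e2 : n + 1 + r + 1 - n = r + 2 := by omega
  have e3 : n + 1 + r - (n + 1) = r := by omega
  rw [e1] at d1
  rw [e2] at d0
  rw [e3]
  obtain ⟨a, b⟩ := coeff_X_sq_mul_toda (hankelDet f (n + 1))
  have hne : -(((hankelDet f (n + 1)).natDegree : ℂ) * (hankelDet f (n + 1)).leadingCoeff ^ 2)
      ≠ 0 := by
    refine neg_ne_zero.2 (mul_ne_zero ?_ (pow_ne_zero 2 (leadingCoeff_ne_zero.2 h1)))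
    rw [d1]
    exact Nat.cast_ne_zero.2 (by positivity)
  rw [← b] at hne
  have hdeg := le_antisymm a (le_natDegree_of_ne_zero hne)
  have hlc := b
  rw [← hdeg, coeff_natDegree] at hlc
  rw [← hankelDet_toda f n h0] at hdeg hlc hne
  have h2 : hankelDet f (n + 2) ≠ 0 := by
    intro h
    simp [h] at hne
  refine ⟨h2, ?_, ?_⟩
  · rw [natDegree_mul (by simp) (mul_ne_zero h2 h0), natDegree_mul h2 h0, d0, d1,
      natDegree_X_pow] at hdeg
    nlinarith
  · rw [leadingCoeff_mul, leadingCoeff_mul, leadingCoeff_X_pow, one_mul] at hlc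
    rw [hlc, d1]
    push_cast
    ring

theorem hankelDet_degree {f : ℂ[X]} (hf : f ≠ 0) {n : ℕ} (hn : n ≤ f.natDegree + 1) :
    hankelDet f n ≠ 0 ∧ (hankelDet f n).natDegree = n * (f.natDegree + 1 - n) := by
  induction n using Nat.twoStepInduction with
  | zero => simp [hankelDet_zero]
  | one => simp [hankelDet_one, hf]
  | more n ih0 ih1 =>
    have A := ih0 (by omega)
    have B := ih1 (by omega)
    have := hankelDet_degree_step (N := f.natDegree) (by omega) A.1 B.1 A.2
      (by rw [B.2]; congr 1; omega)
    exact ⟨this.1, by rw [this.2.1]; congr 1; omega⟩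

theorem hankelDet_leadingCoeff {f : ℂ[X]} (hf : f ≠ 0) {n : ℕ} (hn : n + 1 ≤ f.natDegree) :
    (hankelDet f (n + 2)).leadingCoeff * (hankelDet f n).leadingCoeff =
      -(((n + 1) * (f.natDegree - n) : ℂ) * (hankelDet f (n + 1)).leadingCoeff ^ 2) := by
  have A := hankelDet_degree hf (n := n) (by omega)
  have B := hankelDet_degree hf (n := n + 1) (by omega)
  exact (hankelDet_degree_step hn A.1 B.1 A.2 (by rw [B.2]; congr 1; omega)).2.2

/-- The differential relations between `L_{M+1}^{(α)}(εz)` and `L_M^{(α)}(εz)`, where `ε = ±1`. -/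
structure IsLaguerrePair (ε α : ℂ) (M : ℕ) (f g : ℂ[X]) : Prop where
  sign : ε * ε = 1
  natDegree_left : f.natDegree = M + 1
  natDegree_right : g.natDegree = M
  right_ne_zero : g ≠ 0
  derivative_left : C ε * derivative f = C ε * derivative g - g
  X_mul_derivative : X * derivative f = C ((M : ℂ) + 1) * f - C ((M : ℂ) + 1 + α) * g

/-! ### Laguerre pairs and their ratios -/

namespace IsLaguerrePair

variable {ε α : ℂ} {M : ℕ} {f g : ℂ[X]}

theorem left_ne_zero (h : IsLaguerrePair ε α M f g) : f ≠ 0 := by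
  rintro rfl
  simpa using h.natDegree_left

/-- The sign -ε enters at n = 0, through the coefficient of degree M in `derivative_left`; the
recursions of `hankelDet_leadingCoeff` for f and g then propagate it. -/
theorem leadingCoeff_hankelDet (h : IsLaguerrePair ε α M f g) {n : ℕ} (hn : n ≤ M) :
    (hankelDet f (n + 1)).leadingCoeff * (hankelDet g n).leadingCoeff * ((M : ℂ) + 1 - n) =
      -ε * ((hankelDet f n).leadingCoeff * (hankelDet g (n + 1)).leadingCoeff) := by
  induction n with
  | zero =>
    have := congrArg (coeff · M) h.derivative_left
    simp only [coeff_sub, coeff_C_mul, coeff_derivative] at this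
    rw [coeff_eq_zero_of_natDegree_lt (by rw [h.natDegree_right]; omega : g.natDegree < M + 1),
      zero_mul, mul_zero, zero_sub, ← h.natDegree_left, coeff_natDegree] at this
    nth_rewrite 2 [← h.natDegree_right] at this
    rw [coeff_natDegree] at this
    simp only [zero_add, hankelDet_zero, hankelDet_one, leadingCoeff_one, Nat.cast_zero]
    linear_combination ε * this - f.leadingCoeff * (M + 1) * h.sign
  | succ n ih =>
    have ih := ih (by omega)
    have A := hankelDet_leadingCoeff h.left_ne_zero (n := n) (by rw [h.natDegree_left]; omega)
    have B := hankelDet_leadingCoeff h.right_ne_zero (n := n) (by rw [h.natDegree_right]; omega)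
    have a := (hankelDet_degree h.left_ne_zero (n := n) (by rw [h.natDegree_left]; omega)).1
    have b := (hankelDet_degree h.right_ne_zero (n := n) (by rw [h.natDegree_right]; omega)).1
    rw [← leadingCoeff_ne_zero] at a b
    rw [h.natDegree_left] at A
    rw [h.natDegree_right] at B
    push_cast at A ⊢
    refine mul_left_cancel₀ (mul_ne_zero a b) ?_
    linear_combination (hankelDet g n).leadingCoeff * (hankelDet g (n + 1)).leadingCoeff * (M - n) * A
      + ε * (hankelDet f n).leadingCoeff * (hankelDet f (n + 1)).leadingCoeff * B
      - (n + 1) * (M - n) * (hankelDet f (n + 1)).leadingCoeff * (hankelDet g (n + 1)).leadingCoeff * ih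

/-- The rational function `τ_{n+1} σ_n / (τ_n σ_{n+1})` of the Hankel determinants of a pair. -/
def ratio (K : Type*) [Field K] [Algebra ℂ[X] K] (f g : ℂ[X]) (n : ℕ) : K :=
  algebraMap ℂ[X] K (hankelDet g n * hankelDet f (n + 1)) /
    algebraMap ℂ[X] K (hankelDet f n * hankelDet g (n + 1))

variable (K : Type*) [Field K] [Algebra ℂ[X] K] [IsFractionRing ℂ[X] K]

theorem algebraMap_ne_zero_of_ne_zero {p : ℂ[X]} (hp : p ≠ 0) : algebraMap ℂ[X] K p ≠ 0 :=
  (map_ne_zero_iff _ (IsFractionRing.injective ℂ[X] K)).2 hp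

/-- Taking δ = ε d/dX and the variable εX treats both signs at once: ε² = 1 gives δ(εX) = 1 and
leaves the Toda equation unchanged. -/
theorem pvEquation_ratio (h : IsLaguerrePair ε α M f g) {n : ℕ} (hn : n ≤ M)
    (δ : Derivation ℤ K K)
    (hδ : ∀ p : ℂ[X], δ (algebraMap ℂ[X] K p) =
      algebraMap ℂ[X] K (C ε * derivative p)) :
    ratio K f g n ≠ 0 ∧ ratio K f g n ≠ 1 ∧
      PVEquation δ (algebraMap ℂ[X] K (C ε * X))
        (algebraMap ℂ[X] K (C (((M : ℂ) + 1 - n) ^ 2 / 2)))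
        (algebraMap ℂ[X] K (C (-(((M : ℂ) + 1 + n + α) ^ 2 / 2))))
        (algebraMap ℂ[X] K (C (α - 1))) (ratio K f g n) := by
  have : CharZero K := charZero_of_injective_ringHom (IsFractionRing.injective ℂ[X] K)
  have hε : C ε * C ε = 1 := by rw [← C_mul, h.sign, C_1]
  have hε0 : ε ≠ 0 := left_ne_zero_of_mul_eq_one h.sign
  have hz : algebraMap ℂ[X] K (C ε * X) ≠ 0 :=
    algebraMap_ne_zero_of_ne_zero K (mul_ne_zero (C_ne_zero.2 hε0) X_ne_zero)
  have hδz : δ (algebraMap ℂ[X] K (C ε * X)) = 1 := by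
    rw [hδ]
    simp [hε]
  have hα : δ (algebraMap ℂ[X] K (C α)) = 0 := by
    rw [hδ]
    simp
  have hτ (k : ℕ) (hk : k ≤ M + 2) : algebraMap ℂ[X] K (hankelDet f k) ≠ 0 :=
    algebraMap_ne_zero_of_ne_zero K
      (hankelDet_degree h.left_ne_zero (by rw [h.natDegree_left]; omega)).1
  have hσ (k : ℕ) (hk : k ≤ M + 1) : algebraMap ℂ[X] K (hankelDet g k) ≠ 0 :=
    algebraMap_ne_zero_of_ne_zero K
      (hankelDet_degree h.right_ne_zero (by rw [h.natDegree_right]; omega)).1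
  have toda (p : ℂ[X]) (k : ℕ) (hk : hankelDet p k ≠ 0) :
      algebraMap ℂ[X] K (hankelDet p (k + 2)) *
        algebraMap ℂ[X] K (hankelDet p k) =
      algebraMap ℂ[X] K (hankelDet p (k + 1)) *
        δ (δ (algebraMap ℂ[X] K (hankelDet p (k + 1)))) -
        δ (algebraMap ℂ[X] K (hankelDet p (k + 1))) ^ 2 := by
    rw [hδ, hδ, ← map_mul, ← map_mul, ← map_pow, ← map_sub, hankelDet_toda p k hk]
    generalize hankelDet p (k + 1) = t
    rw [derivative_C_mul]
    refine congrArg _ ?_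
    linear_combination (-(t * derivative (derivative t)) + derivative t ^ 2) * hε
  obtain ⟨c, e, hs⟩ := exists_isChainState (δ := δ) (M := M)
    (τ := fun k => algebraMap ℂ[X] K (hankelDet f k))
    (σ := fun k => algebraMap ℂ[X] K (hankelDet g k)) hz hδz hα hτ hσ
    (by simp [hankelDet_zero]) (by simp [hankelDet_zero])
    (fun k hk => toda f k (hankelDet_degree h.left_ne_zero (by rw [h.natDegree_left]; omega)).1)
    (fun k hk => toda g k (hankelDet_degree h.right_ne_zero (by rw [h.natDegree_right]; omega)).1)
    (by simp only [hankelDet_one]; rw [hδ, hδ, ← map_sub, h.derivative_left])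
    (by
      simp only [hankelDet_one]
      rw [hδ, ← map_mul]
      have : C ε * X * (C ε * derivative f) = X * derivative f := by
        linear_combination X * derivative f * hε
      rw [this, h.X_mul_derivative]
      simp) n hn
  have hw : algebraMap ℂ[X] K (hankelDet g n) *
      algebraMap ℂ[X] K (hankelDet f (n + 1)) /
      (algebraMap ℂ[X] K (hankelDet f n) *
      algebraMap ℂ[X] K (hankelDet g (n + 1))) = ratio K f g n := by
    rw [ratio, map_mul, map_mul]
  have hpv := hs.pvEquation hz hδz hα (by simp) (by simp)
  rw [hw] at hpv
  refine ⟨hw ▸ hs.w_ne_zero, hw ▸ hs.w_ne_one, ?_⟩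
  have hC (x : ℂ) (y : K) (hxy : algebraMap ℂ[X] K (C (x)) = y) :
      algebraMap ℂ[X] K (C (x ^ 2 / 2)) = y ^ 2 / 2 := by
    rw [← hxy, eq_div_iff two_ne_zero, ← map_ofNat (algebraMap ℂ[X] K), ← map_mul,
      ← map_pow, ← map_ofNat C, ← C_mul, ← C_pow]
    congr 2
    ring
  convert hpv using 1
  · exact hC _ _ (by simp)
  · rw [C_neg, map_neg, hC _ (M + 1 + n + algebraMap ℂ[X] K (C α)) (by simp)]
  · simp

/-- By `leadingCoeff_hankelDet` the quotients of leading coefficients are -1/(M + 1 - n) and +1/(M +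
1 - n); equality of the fractions would make them agree. -/
theorem ratio_ne_ratio {α' : ℂ} {M' n n' : ℕ} {f' g' : ℂ[X]} (h : IsLaguerrePair 1 α M f g)
    (h' : IsLaguerrePair (-1) α' M' f' g') (hn : n ≤ M) (hn' : n' ≤ M')
    (hM : (M : ℂ) + 1 - n = (M' : ℂ) + 1 - n') : ratio K f g n ≠ ratio K f' g' n' := by
  have a0 := (hankelDet_degree h.left_ne_zero (n := n) (by rw [h.natDegree_left]; omega)).1
  have b1 := (hankelDet_degree h.right_ne_zero (n := n + 1) (by rw [h.natDegree_right]; omega)).1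
  have a0' := (hankelDet_degree h'.left_ne_zero (n := n') (by rw [h'.natDegree_left]; omega)).1
  have b1' := (hankelDet_degree h'.right_ne_zero (n := n' + 1)
    (by rw [h'.natDegree_right]; omega)).1
  intro heq
  unfold ratio at heq
  rw [div_eq_div_iff (algebraMap_ne_zero_of_ne_zero K (mul_ne_zero a0 b1))
    (algebraMap_ne_zero_of_ne_zero K (mul_ne_zero a0' b1')), ← map_mul, ← map_mul] at heq
  have h1 := congrArg leadingCoeff (IsFractionRing.injective ℂ[X] K heq)
  simp only [leadingCoeff_mul] at h1
  have l := h.leadingCoeff_hankelDet hn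
  have l' := h'.leadingCoeff_hankelDet hn'
  rw [← hM] at l'
  rw [← leadingCoeff_ne_zero] at a0 b1 a0' b1'
  have : (2 : ℂ) * ((hankelDet f n).leadingCoeff * (hankelDet g (n + 1)).leadingCoeff) *
      ((hankelDet f' n').leadingCoeff * (hankelDet g' (n' + 1)).leadingCoeff) = 0 := by
    linear_combination -((hankelDet f n).leadingCoeff * (hankelDet g (n + 1)).leadingCoeff) * l'
      + (hankelDet f' n').leadingCoeff * (hankelDet g' (n' + 1)).leadingCoeff * l
      - ((M : ℂ) + 1 - n) * h1
  exact mul_ne_zero (mul_ne_zero two_ne_zero (mul_ne_zero a0 b1)) (mul_ne_zero a0' b1') this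

end IsLaguerrePair

end

/-! ### Contiguous relations for Laguerre polynomials -/

theorem coeff_laguerreNat (n : ℕ) (α : ℂ) (i : ℕ) :
    (laguerreNat n α).coeff i = if i ≤ n then
      (-1) ^ i * (ascPochhammer ℂ (n - i)).eval (α + i + 1) / ((n - i).factorial * i.factorial)
      else 0 := by
  simp only [laguerreNat, finsetSum_coeff, coeff_C_mul, coeff_X_pow, mul_ite, mul_one, mul_zero]
  rw [Finset.sum_ite_eq]
  simp

theorem coeff_laguerreNat_add (i j : ℕ) (α : ℂ) :
    (laguerreNat (i + j) α).coeff i =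
      (-1) ^ i * (ascPochhammer ℂ j).eval (α + i + 1) / (j.factorial * i.factorial) := by
  rw [coeff_laguerreNat, if_pos (Nat.le_add_right i j), Nat.add_sub_cancel_left]

theorem coeff_laguerreNat_of_lt {n i : ℕ} (h : n < i) (α : ℂ) :
    (laguerreNat n α).coeff i = 0 := by
  rw [coeff_laguerreNat, if_neg (not_le.2 h)]

theorem coeff_laguerreNat_self (n : ℕ) (α : ℂ) : (laguerreNat n α).coeff n ≠ 0 := by
  rw [coeff_laguerreNat, if_pos le_rfl]
  simp [Nat.factorial_ne_zero]

theorem natDegree_laguerreNat (n : ℕ) (α : ℂ) : (laguerreNat n α).natDegree = n :=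
  le_antisymm (natDegree_le_iff_coeff_eq_zero.2 fun _ h => coeff_laguerreNat_of_lt h α)
    (le_natDegree_of_ne_zero (coeff_laguerreNat_self n α))

theorem laguerreNat_ne_zero (n : ℕ) (α : ℂ) : laguerreNat n α ≠ 0 := fun h =>
  coeff_laguerreNat_self n α (by rw [h, coeff_zero])

theorem derivative_laguerreNat_succ (n : ℕ) (α : ℂ) :
    derivative (laguerreNat (n + 1) α) = derivative (laguerreNat n α) - laguerreNat n α := by
  ext i
  rw [coeff_sub, coeff_derivative, coeff_derivative]
  rcases lt_or_ge n i with h | h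
  · rw [coeff_laguerreNat_of_lt h, coeff_laguerreNat_of_lt (by omega : n + 1 < i + 1),
      coeff_laguerreNat_of_lt (by omega : n < i + 1)]
    ring
  · obtain ⟨j, rfl⟩ := Nat.exists_eq_add_of_le h
    rw [show i + j + 1 = (i + 1) + j by ring, coeff_laguerreNat_add, coeff_laguerreNat_add]
    have hi : (i.factorial : ℂ) ≠ 0 := by exact_mod_cast i.factorial_ne_zero
    have hi' : (i : ℂ) + 1 ≠ 0 := by exact_mod_cast i.succ_ne_zero
    cases j with
    | zero =>
      rw [coeff_laguerreNat_of_lt (by omega : i + 0 < i + 1)]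
      simp only [ascPochhammer_zero, eval_one, Nat.factorial_succ, Nat.factorial_zero, pow_succ]
      push_cast
      field_simp
      ring
    | succ j =>
      rw [show i + (j + 1) = (i + 1) + j by ring, coeff_laguerreNat_add]
      have hj : (j.factorial : ℂ) ≠ 0 := by exact_mod_cast j.factorial_ne_zero
      have hj' : (j : ℂ) + 1 ≠ 0 := by exact_mod_cast j.succ_ne_zero
      rw [ascPochhammer_succ_eval, ascPochhammer_succ_left ℂ j]
      simp only [eval_mul, eval_comp, eval_X, eval_add, eval_one, Nat.factorial_succ, pow_succ]
      push_cast
      rw [← add_assoc α]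
      field_simp
      ring

theorem X_mul_derivative_laguerreNat_succ (n : ℕ) (α : ℂ) :
    X * derivative (laguerreNat (n + 1) α) =
      C ((n : ℂ) + 1) * laguerreNat (n + 1) α - C ((n : ℂ) + 1 + α) * laguerreNat n α := by
  ext i
  have h1 (p : ℂ[X]) : (X * derivative p).coeff i = i * p.coeff i := by
    cases i with
    | zero => simp
    | succ k => rw [coeff_X_mul, coeff_derivative]; push_cast; ring
  rw [h1, coeff_sub, coeff_C_mul, coeff_C_mul]
  rcases lt_trichotomy i (n + 1) with h | rfl | h
  · obtain ⟨j, rfl⟩ := Nat.exists_eq_add_of_le (Nat.lt_succ_iff.1 h)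
    rw [add_assoc i j 1, coeff_laguerreNat_add, coeff_laguerreNat_add]
    have hi : (i.factorial : ℂ) ≠ 0 := by exact_mod_cast i.factorial_ne_zero
    have hj : (j.factorial : ℂ) ≠ 0 := by exact_mod_cast j.factorial_ne_zero
    have hj' : (j : ℂ) + 1 ≠ 0 := by exact_mod_cast j.succ_ne_zero
    rw [ascPochhammer_succ_eval, Nat.factorial_succ]
    push_cast
    field_simp
    ring
  · rw [coeff_laguerreNat_of_lt (Nat.lt_succ_self n)]
    push_cast
    ring
  · rw [coeff_laguerreNat_of_lt h, coeff_laguerreNat_of_lt (by omega : n < i)]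
    ring

theorem isLaguerrePair (M : ℕ) (α : ℂ) :
    IsLaguerrePair 1 α M (laguerreNat (M + 1) α) (laguerreNat M α) where
  sign := one_mul 1
  natDegree_left := natDegree_laguerreNat _ _
  natDegree_right := natDegree_laguerreNat _ _
  right_ne_zero := laguerreNat_ne_zero _ _
  derivative_left := by simp [derivative_laguerreNat_succ]
  X_mul_derivative := X_mul_derivative_laguerreNat_succ M α

theorem isLaguerrePair_comp_neg_X (M : ℕ) (α : ℂ) :
    IsLaguerrePair (-1) α M ((laguerreNat (M + 1) α).comp (-X)) ((laguerreNat M α).comp (-X)) where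
  sign := by norm_num
  natDegree_left := by rw [natDegree_comp, natDegree_laguerreNat]; simp
  natDegree_right := by rw [natDegree_comp, natDegree_laguerreNat]; simp
  right_ne_zero := by
    intro h
    have := congrArg (·.comp (-X)) h
    simp only [comp_neg_X_comp_neg_X, zero_comp] at this
    exact laguerreNat_ne_zero _ _ this
  derivative_left := by
    simp [derivative_comp, derivative_laguerreNat_succ]
  X_mul_derivative := by
    have := congrArg (·.comp (-X)) (X_mul_derivative_laguerreNat_succ M α)
    simp only [mul_comp, sub_comp, X_comp, C_comp] at this
    rw [← this, derivative_comp]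
    simp

/-! ### The two families of solutions -/

theorem w_eq_ratio (m n : ℕ) (μ : ℂ) :
    w (m + 1) n μ = IsLaguerrePair.ratio (RatFunc ℂ) (laguerreNat (m + n + 1) (μ + 1))
      (laguerreNat (m + n) (μ + 1)) n := by
  -- All four Laguerre indices are natural numbers, so the zero convention for negative index never
  -- intervenes.
  have e1 : ((m + 1 : ℕ) : ℤ) - 1 + n = (m + n : ℕ) := by push_cast; ring
  have e2 : ((m + 1 : ℕ) : ℤ) - 1 + (n + 1 : ℕ) = (m + n + 1 : ℕ) := by push_cast; ring
  have e3 : ((m + 1 : ℕ) : ℤ) + n = (m + n + 1 : ℕ) := by push_cast; ring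
  have e4 : ((m + 1 : ℕ) : ℤ) - 2 + (n + 1 : ℕ) = (m + n : ℕ) := by push_cast; ring
  unfold w genLaguerre
  rw [e1, e2, e3, e4]
  rfl

theorem wHat_eq_ratio (m n : ℕ) (μ : ℂ) :
    wHat (m + 1) n μ = IsLaguerrePair.ratio (RatFunc ℂ)
      ((laguerreNat (m + n + 1) (μ + 1)).comp (-X)) ((laguerreNat (m + n) (μ + 1)).comp (-X)) n := by
  have e1 : ((m + 1 : ℕ) : ℤ) - 1 + n = (m + n : ℕ) := by push_cast; ring
  have e2 : ((m + 1 : ℕ) : ℤ) - 1 + (n + 1 : ℕ) = (m + n + 1 : ℕ) := by push_cast; ring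
  have e3 : ((m + 1 : ℕ) : ℤ) + n = (m + n + 1 : ℕ) := by push_cast; ring
  have e4 : ((m + 1 : ℕ) : ℤ) - 2 + (n + 1 : ℕ) = (m + n : ℕ) := by push_cast; ring
  unfold wHat genLaguerreHat
  rw [e1, e2, e3, e4]
  rfl

theorem isRationalSolutionPV_w (m n : ℕ) (μ : ℂ) :
    IsRationalSolutionPV (((m : ℂ) + 1) ^ 2 / 2) (-(((m : ℂ) + 1 + 2 * n + μ + 1) ^ 2 / 2)) μ
      (w (m + 1) n μ) := by
  obtain ⟨h0, h1, h⟩ := (isLaguerrePair (m + n) (μ + 1)).pvEquation_ratio (RatFunc ℂ)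
    (Nat.le_add_left n m) (fracDerivation ℂ (RatFunc ℂ))
    (fun p => by rw [C_1, one_mul]; exact fracDerivation_algebraMap ℂ (RatFunc ℂ) p)
  rw [← w_eq_ratio] at h0 h1 h
  refine isRationalSolutionPV_of_pvEquation h0 h1 ?_
  rw [C_1, one_mul] at h
  convert h using 4
  · push_cast; ring
  · push_cast; ring
  · ring

/-- Under z ↦ -z only the term γw/z changes sign. -/
theorem PVEquation.neg {K : Type*} [Field K] {δ : Derivation ℤ K K} {z α β γ w : K}
    (h : PVEquation (-δ) (-z) α β γ w) : PVEquation δ z α β (-γ) w := by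
  unfold PVEquation at h ⊢
  simp only [Derivation.neg_apply, map_neg, neg_neg, even_two, Even.neg_pow, mul_neg, div_neg, neg_mul] at h
  rw [h]
  ring

theorem isRationalSolutionPV_wHat (m n : ℕ) (μ : ℂ) :
    IsRationalSolutionPV (((m : ℂ) + 1) ^ 2 / 2) (-(((m : ℂ) + 1 + 2 * n + μ + 1) ^ 2 / 2)) (-μ)
      (wHat (m + 1) n μ) := by
  obtain ⟨h0, h1, h⟩ := (isLaguerrePair_comp_neg_X (m + n) (μ + 1)).pvEquation_ratio (RatFunc ℂ)
    (Nat.le_add_left n m) (-fracDerivation ℂ (RatFunc ℂ))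
    (fun p => by
      rw [C_neg, C_1, neg_one_mul, map_neg, ← fracDerivation_algebraMap ℂ (RatFunc ℂ) p]
      rfl)
  rw [← wHat_eq_ratio] at h0 h1 h
  refine isRationalSolutionPV_of_pvEquation h0 h1 ?_
  rw [C_neg, C_1, neg_one_mul, map_neg] at h
  have h' := h.neg
  rw [← map_neg, ← C_neg] at h'
  rw [add_sub_cancel_right] at h'
  convert h' using 4
  · push_cast; ring
  · push_cast; ring

theorem w_ne_wHat (m n n' : ℕ) (μ μ' : ℂ) : w (m + 1) n μ ≠ wHat (m + 1) n' μ' := by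
  rw [w_eq_ratio, wHat_eq_ratio]
  exact (isLaguerrePair (m + n) (μ + 1)).ratio_ne_ratio (RatFunc ℂ)
    (isLaguerrePair_comp_neg_X (m + n') (μ' + 1)) (Nat.le_add_left n m) (Nat.le_add_left n' m)
    (by push_cast; ring)

end PainleveV

end

theorem mainTheorem3 (m n : ℕ) (hm : 1 ≤ m) (k : ℤ) (hk : -(n : ℤ) ≤ k) :
    PainleveV.IsRationalSolutionPV
        ((m : ℂ) ^ 2 / 2) (-(((m : ℂ) + 2 * n + k + 1) ^ 2 / 2)) k
        (PainleveV.w m n k) ∧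
      PainleveV.IsRationalSolutionPV
        ((m : ℂ) ^ 2 / 2) (-(((m : ℂ) + 2 * n + k + 1) ^ 2 / 2)) k
        (PainleveV.wHat m ((n : ℤ) + k).toNat (-k)) ∧
      PainleveV.w m n k ≠ PainleveV.wHat m ((n : ℤ) + k).toNat (-k) := by
  obtain ⟨m, rfl⟩ : ∃ m', m = m' + 1 := ⟨m - 1, by omega⟩
  -- Here k ≥ -n is what keeps `toNat` from truncating.
  have hn : ((((n : ℤ) + k).toNat : ℕ) : ℂ) = n + k := by
    have : ((((n : ℤ) + k).toNat : ℕ) : ℤ) = n + k := Int.toNat_of_nonneg (by omega)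
    exact_mod_cast this
  refine ⟨?_, ?_, PainleveV.w_ne_wHat m n _ _ _⟩
  · convert PainleveV.isRationalSolutionPV_w m n k using 2 <;> push_cast <;> ring
  · convert PainleveV.isRationalSolutionPV_wHat m ((n : ℤ) + k).toNat (-k) using 2
    · push_cast; ring
    · rw [hn]; push_cast; ring
    · ring
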